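/- Let $n$ be a natural number and let $d\in\mathbb{C}$ satisfy $d^2=n$. For a complex matrix $C$ with no zero entry let $C^{(-)}$ denote its entrywise inverse, $(C^{(-)})_{i,j}=1/C_{i,j}$. An $m\times m$ complex matrix $C$ is *type II* if it has no zero entry and $C\,(C^{(-)})^{T}=mI$. For an $m\times m$ complex matrix $C$ let $X_C$ and $\Delta_C$ be the linear operators on $m\times m$ complex matrices given by $X_C(M)=CM$ and $\Delta_C(M)=C\circ M$, where $\circ$ is the entrywise product. A pair $(A,B)$ of $m\times m$ complex matrices is a *one-sided Jones pair* if $X_A\Delta_BX_A=\Delta_BX_A\Delta_B$; it is a *Jones pair* if both $(A,B)$ and $(A,B^T)$ are one-sided Jones pairs, and it is *invertible* if $X_A$ and $\Delta_B$ are invertible operators. A symmetric $m\times m$ matrix $W$ is a *symmetric spin model with loop variable $D$* if $D^2=m$, $W$ is type II, and $$\sum_{x=1}^{m}\frac{W_{a,x}W_{b,x}}{W_{c,x}}=D\,\frac{W_{a,b}}{W_{a,c}W_{b,c}}\qquad\text{for all } a,b,c\in\{1,\dots,m\}.$$ **Theorem.** Let $A$ and $B$ be $n\times n$ type-II matrices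 with $A$ symmetric. Then the $4n\times 4n$ matrix $$V=\begin{pmatrix} dA & -dA & B^{(-)} & B^{(-)}\\ -dA & dA & B^{(-)} & B^{(-)}\\ B^{(-)T} & B^{(-)T} & dA & -dA\\ B^{(-)T} & B^{(-)T} & -dA & dA\end{pmatrix}$$ is a symmetric spin model with loop variable $2d$ if and only if $(A,B)$ is an invertible Jones pair. -/

import Mathlib

namespace JonesPairs

open scoped Matrix

variable {ι : Type*}

/-- The Schur (entrywise) inverse `C^{(-)}` of a complex matrix. It is used only for matrices
with no zero entry. -/
noncomputable def schurInv (C : Matrix ι ι ℂ) : Matrix ι ι ℂ := C.map fun z => z⁻¹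

/-- A square complex matrix of order `n` is type II if it has no zero entry and
`C * (C^{(-)})ᵀ = n • 1`. -/
structure IsTypeII [Fintype ι] [DecidableEq ι] (C : Matrix ι ι ℂ) : Prop where
  ne_zero : ∀ i j, C i j ≠ 0
  mul_schurInv_transpose : C * (schurInv C)ᵀ = (Fintype.card ι : ℂ) • (1 : Matrix ι ι ℂ)

/-- The operator `X_C : M ↦ C * M` on square matrices. -/
def opX [Fintype ι] (C : Matrix ι ι ℂ) : Module.End ℂ (Matrix ι ι ℂ) where
  toFun M := C * M
  map_add' := Matrix.mul_add C
  map_smul' c M := Matrix.mul_smul C c M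

/-- The operator `Δ_C : M ↦ C ∘ M` (Schur, i.e. entrywise, product) on square matrices. -/
def opDelta (C : Matrix ι ι ℂ) : Module.End ℂ (Matrix ι ι ℂ) where
  toFun M := C ⊙ M
  map_add' M N := Matrix.hadamard_add C M N
  map_smul' c M := Matrix.hadamard_smul C M c

/-- `(A, B)` is a one-sided Jones pair: `X_A Δ_B X_A = Δ_B X_A Δ_B`. -/
def IsOneSidedJonesPair [Fintype ι] (A B : Matrix ι ι ℂ) : Prop :=
  opX A * opDelta B * opX A = opDelta B * opX A * opDelta B

/-- `(A, B)` is a Jones pair if both `(A, B)` and `(A, Bᵀ)` are one-sided Jones pairs. -/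
def IsJonesPair [Fintype ι] (A B : Matrix ι ι ℂ) : Prop :=
  IsOneSidedJonesPair A B ∧ IsOneSidedJonesPair A Bᵀ

/-- A Jones pair `(A, B)` is invertible if the operators `X_A` and `Δ_B` are invertible. -/
def IsInvertibleJonesPair [Fintype ι] (A B : Matrix ι ι ℂ) : Prop :=
  IsJonesPair A B ∧ IsUnit (opX A) ∧ IsUnit (opDelta B)

/-- `W` is a symmetric spin model with loop variable `D`: the matrix `W` is symmetric and type II,
`D` is a square root of the order of `W`, and the star-triangle relation holds. -/
structure IsSymmetricSpinModel [Fintype ι] [DecidableEq ι] (W : Matrix ι ι ℂ) (D : ℂ) : Prop where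
  symm : W.IsSymm
  loop_sq : D ^ 2 = (Fintype.card ι : ℂ)
  typeII : IsTypeII W
  star_triangle : ∀ a b c,
    ∑ x, W a x * W b x / W c x = D * (W a b / (W a c * W b c))

/-- The `4n × 4n` matrix
```
  dA        -dA       B^(-)   B^(-)
 -dA         dA       B^(-)   B^(-)
  B^(-)ᵀ     B^(-)ᵀ   dA     -dA
  B^(-)ᵀ     B^(-)ᵀ  -dA      dA
```
-/
noncomputable def matV (d : ℂ) (A B : Matrix ι ι ℂ) :
    Matrix ((ι ⊕ ι) ⊕ (ι ⊕ ι)) ((ι ⊕ ι) ⊕ (ι ⊕ ι)) ℂ :=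
  Matrix.fromBlocks
    (Matrix.fromBlocks (d • A) (-(d • A)) (-(d • A)) (d • A))
    (Matrix.fromBlocks (schurInv B) (schurInv B) (schurInv B) (schurInv B))
    (Matrix.fromBlocks (schurInv B)ᵀ (schurInv B)ᵀ (schurInv B)ᵀ (schurInv B)ᵀ)
    (Matrix.fromBlocks (d • A) (-(d • A)) (-(d • A)) (d • A))

end JonesPairs

namespace JonesPairs

open scoped Matrix

section

variable {ι : Type*} [Fintype ι]

/-! ### Entrywise form of the one-sided Jones pair relation -/

/-! Index the rows of `V` by a half, a sign and a base index. The `dA` blocks carry the product of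
the two signs, and the `B` blocks carry none. In a sum over a column index, each half therefore
cancels if the sign of that index occurs an odd number of times, and otherwise doubles. Exchanging
the halves replaces `B` by `Bᵀ`, so star-triangle need only be checked with at least two indices in
the first half.

Three identities remain. With the denominator index in the second half, the relation is the braid
relation itself, times `2 * d ^ 2`; this gives the converse. The other two are `sum_div_mul` and
`sum_div_mul_self`: both follow by inverting the braid relation, where type II turns inverses into
entrywise reciprocals. The type-II property of `V`, like invertibility of the pair, needs only that
`A` and `B` are type II (and `d ≠ 0` for `V`). -/

theorem isOneSidedJonesPair_iff_entries {A B : Matrix ι ι ℂ} :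
    IsOneSidedJonesPair A B ↔
      ∀ i j k, ∑ x, A i x * B x k * A x j = B i k * A i j * B j k := by
  classical
  have key : ∀ M : Matrix ι ι ℂ, ∀ i k,
      ((opX A * opDelta B * opX A) M i k = ∑ j, (∑ x, A i x * B x k * A x j) * M j k) ∧
      ((opDelta B * opX A * opDelta B) M i k = ∑ j, (B i k * A i j * B j k) * M j k) := by
    intro M i k
    constructor
    · simp only [Module.End.mul_apply, opX, opDelta, LinearMap.coe_mk, AddHom.coe_mk,
        Matrix.mul_apply, Matrix.hadamard_apply, Finset.mul_sum, Finset.sum_mul]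
      rw [Finset.sum_comm]
      exact Finset.sum_congr rfl fun _ _ => Finset.sum_congr rfl fun _ _ => by ring
    · simp only [Module.End.mul_apply, opX, opDelta, LinearMap.coe_mk, AddHom.coe_mk,
        Matrix.mul_apply, Matrix.hadamard_apply, Finset.mul_sum]
      exact Finset.sum_congr rfl fun _ _ => by ring
  constructor
  · intro h i j k
    -- A matrix unit isolates one coefficient on each side.
    have h1 := congrFun (congrFun (congrArg (fun T => T (Matrix.single j k 1)) h) i) k
    simp only [(key _ i k).1, (key _ i k).2] at h1
    simpa [Matrix.single_apply] using h1
  · intro h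
    refine LinearMap.ext fun M => Matrix.ext fun i k => ?_
    rw [(key M i k).1, (key M i k).2]
    simp only [h]

theorem isOneSidedJonesPair_iff_of_isSymm {A B : Matrix ι ι ℂ} (hA : A.IsSymm) :
    IsOneSidedJonesPair A B ↔
      ∀ i j k, ∑ x, A i x * A j x * B x k = A i j * B i k * B j k := by
  rw [isOneSidedJonesPair_iff_entries]
  refine forall_congr' fun i => forall_congr' fun j => forall_congr' fun k => ?_
  have h1 : ∑ x, A i x * B x k * A x j = ∑ x, A i x * A j x * B x k :=
    Finset.sum_congr rfl fun x _ => by rw [hA.apply j x]; ring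
  have h2 : B i k * A i j * B j k = A i j * B i k * B j k := by ring
  rw [h1, h2]

/-! ### Type-II matrices -/

variable [DecidableEq ι]

namespace IsTypeII

theorem sum_div {C : Matrix ι ι ℂ} (hC : IsTypeII C) (a c : ι) :
    ∑ x, C a x / C c x = if a = c then (Fintype.card ι : ℂ) else 0 := by
  have h := congrFun (congrFun hC.mul_schurInv_transpose a) c
  simpa [Matrix.mul_apply, schurInv, Matrix.one_apply, div_eq_mul_inv] using h

theorem mul_smul_schurInv_transpose [Nonempty ι] {C : Matrix ι ι ℂ} (hC : IsTypeII C) :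
    C * ((Fintype.card ι : ℂ)⁻¹ • (schurInv C)ᵀ) = 1 := by
  have hn : (Fintype.card ι : ℂ) ≠ 0 := by simp
  rw [Matrix.mul_smul, hC.mul_schurInv_transpose, smul_smul, inv_mul_cancel₀ hn, one_smul]

theorem inv_eq [Nonempty ι] {C : Matrix ι ι ℂ} (hC : IsTypeII C) :
    C⁻¹ = (Fintype.card ι : ℂ)⁻¹ • (schurInv C)ᵀ :=
  Matrix.inv_eq_right_inv hC.mul_smul_schurInv_transpose

theorem inv_apply [Nonempty ι] {C : Matrix ι ι ℂ} (hC : IsTypeII C) (i j : ι) :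
    C⁻¹ i j = (Fintype.card ι : ℂ)⁻¹ * (C j i)⁻¹ := by
  rw [hC.inv_eq]
  simp [schurInv]

theorem isUnit_det [Nonempty ι] {C : Matrix ι ι ℂ} (hC : IsTypeII C) : IsUnit C.det :=
  Matrix.isUnit_det_of_right_inverse hC.mul_smul_schurInv_transpose

/-- A right inverse of a square matrix is also a left inverse. -/
theorem transpose {C : Matrix ι ι ℂ} (hC : IsTypeII C) : IsTypeII Cᵀ := by
  refine ⟨fun i j => hC.ne_zero j i, ?_⟩
  cases isEmpty_or_nonempty ι
  · exact Subsingleton.elim _ _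
  have hn : (Fintype.card ι : ℂ) ≠ 0 := by simp
  have h := mul_eq_one_comm.mp hC.mul_smul_schurInv_transpose
  have h1 : (schurInv C)ᵀ * C = (Fintype.card ι : ℂ) • (1 : Matrix ι ι ℂ) := by
    rw [← h, Matrix.smul_mul, smul_smul, mul_inv_cancel₀ hn, one_smul]
  have h2 := congrArg Matrix.transpose h1
  simpa [Matrix.transpose_mul, schurInv, Matrix.transpose_map] using h2

theorem isUnit_opX {C : Matrix ι ι ℂ} (hC : IsTypeII C) : IsUnit (opX C) := by
  cases isEmpty_or_nonempty ι
  · exact isUnit_of_subsingleton _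
  refine ⟨⟨opX C, opX C⁻¹, ?_, ?_⟩, rfl⟩ <;> refine LinearMap.ext fun M => ?_
  · exact Matrix.mul_nonsing_inv_cancel_left C M hC.isUnit_det
  · exact Matrix.nonsing_inv_mul_cancel_left C M hC.isUnit_det

theorem isUnit_opDelta {C : Matrix ι ι ℂ} (hC : IsTypeII C) : IsUnit (opDelta C) := by
  refine ⟨⟨opDelta C, opDelta (schurInv C), ?_, ?_⟩, rfl⟩ <;>
    refine LinearMap.ext fun M => Matrix.ext fun i j => ?_
  · exact mul_inv_cancel_left₀ (hC.ne_zero i j) (M i j)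
  · exact inv_mul_cancel_left₀ (hC.ne_zero i j) (M i j)

end IsTypeII

/-! ### Consequences of the braid relation for type-II matrices -/

/-- Both operators act on each column separately; on column `k`, `opDelta B` is multiplication by a
diagonal matrix. This form can be inverted. -/
theorem isOneSidedJonesPair_diagonal {A B : Matrix ι ι ℂ} (h : IsOneSidedJonesPair A B) (k : ι) :
    A * Matrix.diagonal (B.col k) * A =
      Matrix.diagonal (B.col k) * A * Matrix.diagonal (B.col k) := by
  ext i j
  have := isOneSidedJonesPair_iff_entries.mp h i j k
  rw [Matrix.mul_diagonal, Matrix.diagonal_mul, Matrix.mul_apply]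
  simpa only [Matrix.mul_diagonal, Matrix.col_apply] using this

variable {A B : Matrix ι ι ℂ}

theorem inv_diagonal_col (hB : ∀ i j, B i j ≠ 0) (k : ι) :
    (Matrix.diagonal (B.col k))⁻¹ = Matrix.diagonal ((schurInv B).col k) := by
  refine Matrix.inv_eq_right_inv ?_
  rw [Matrix.diagonal_mul_diagonal, ← Matrix.diagonal_one]
  congr 1
  ext x
  exact mul_inv_cancel₀ (hB x k)

theorem isUnit_det_diagonal_col (hB : ∀ i j, B i j ≠ 0) (k : ι) :
    IsUnit (Matrix.diagonal (B.col k)).det := by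
  rw [Matrix.det_diagonal, isUnit_iff_ne_zero, Finset.prod_ne_zero_iff]
  exact fun i _ => hB i k

/-- The inverse of the braid relation. -/
theorem sum_inv_inv_inv (hA : IsTypeII A) (hB : ∀ i j, B i j ≠ 0) (hAs : A.IsSymm)
    (h : IsOneSidedJonesPair A B) (i j k : ι) :
    ∑ x, (A i x)⁻¹ * (A j x)⁻¹ * (B x k)⁻¹ =
      Fintype.card ι * ((A i j)⁻¹ * (B i k)⁻¹ * (B j k)⁻¹) := by
  have : Nonempty ι := ⟨i⟩
  have hn : (Fintype.card ι : ℂ) ≠ 0 := by simp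
  have h1 := congrArg (·⁻¹) (isOneSidedJonesPair_diagonal h k)
  simp only [Matrix.mul_inv_rev, inv_diagonal_col hB] at h1
  have h2 := congrFun (congrFun h1 i) j
  rw [← Matrix.mul_assoc, ← Matrix.mul_assoc, Matrix.mul_diagonal, Matrix.diagonal_mul,
    Matrix.mul_apply] at h2
  simp only [Matrix.mul_diagonal, Matrix.col_apply, hA.inv_apply, schurInv, Matrix.map_apply] at h2
  have h3 : ∑ x, (A i x)⁻¹ * (A j x)⁻¹ * (B x k)⁻¹ = (Fintype.card ι : ℂ) ^ 2 *
      ∑ x, (Fintype.card ι : ℂ)⁻¹ * (A x i)⁻¹ * (B x k)⁻¹ *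
        ((Fintype.card ι : ℂ)⁻¹ * (A j x)⁻¹) := by
    rw [Finset.mul_sum]
    refine Finset.sum_congr rfl fun x _ => ?_
    rw [hAs.apply i x]
    field_simp
  rw [h3, h2, hAs.apply i j]
  field_simp

/-- With `D` the diagonal matrix of column `b` of `B`, inverting `A D A = D A D` and multiplying by
`A` on the left and `D` on the right gives `D⁻¹ A⁻¹ D = A D⁻¹ A⁻¹`, read here entrywise. -/
theorem sum_div_mul (hA : IsTypeII A) (hB : ∀ i j, B i j ≠ 0) (hAs : A.IsSymm)
    (h : IsOneSidedJonesPair A B) (a b c : ι) :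
    ∑ x, A a x / (A c x * B x b) = B c b / (B a b * A a c) := by
  have : Nonempty ι := ⟨a⟩
  have hn : (Fintype.card ι : ℂ) ≠ 0 := by simp
  have hD := isUnit_det_diagonal_col hB b
  have h1 := congrArg (fun M => A * M * Matrix.diagonal (B.col b))
    (congrArg (·⁻¹) (isOneSidedJonesPair_diagonal h b))
  simp only [Matrix.mul_inv_rev] at h1
  rw [Matrix.mul_nonsing_inv_cancel_left _ _ hA.isUnit_det, ← Matrix.mul_assoc,
    ← Matrix.mul_assoc, Matrix.nonsing_inv_mul_cancel_right _ _ hD,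
    inv_diagonal_col hB] at h1
  have h2 := congrFun (congrFun h1 a) c
  rw [Matrix.mul_diagonal, Matrix.diagonal_mul, Matrix.mul_apply] at h2
  simp only [Matrix.mul_diagonal, Matrix.col_apply, hA.inv_apply, schurInv, Matrix.map_apply] at h2
  have h3 : ∑ x, A a x / (A c x * B x b) = (Fintype.card ι : ℂ) *
      ∑ x, A a x * (B x b)⁻¹ * ((Fintype.card ι : ℂ)⁻¹ * (A c x)⁻¹) := by
    rw [Finset.mul_sum]
    refine Finset.sum_congr rfl fun x _ => ?_
    field_simp
  rw [h3, ← h2, hAs.apply a c]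
  field_simp

/-- The inverted braid relation expands `(B a k)⁻¹ * (B b k)⁻¹` in the `(B x k)⁻¹`. After
multiplying by `B c k` and summing over `k`, row orthogonality of `B` leaves only `x = c`. -/
theorem sum_div_mul_self (hA : IsTypeII A) (hB : IsTypeII B) (hAs : A.IsSymm)
    (h : IsOneSidedJonesPair A B) (a b c : ι) :
    ∑ x, B c x / (B a x * B b x) = A a b / (A a c * A b c) := by
  have : Nonempty ι := ⟨a⟩
  have hn : (Fintype.card ι : ℂ) ≠ 0 := by simp
  have hab := hA.ne_zero a b
  have h1 : ∀ k, (B a k)⁻¹ * (B b k)⁻¹ = (Fintype.card ι : ℂ)⁻¹ * A a b *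
      ∑ x, (A a x)⁻¹ * (A b x)⁻¹ * (B x k)⁻¹ := fun k => by
    rw [sum_inv_inv_inv hA hB.ne_zero hAs h a b k]
    field_simp
  calc ∑ k, B c k / (B a k * B b k)
      = ∑ k, ∑ x, (Fintype.card ι : ℂ)⁻¹ * A a b * ((A a x)⁻¹ * (A b x)⁻¹) *
          (B c k / B x k) := by
        refine Finset.sum_congr rfl fun k _ => ?_
        rw [div_eq_mul_inv, mul_inv, h1, Finset.mul_sum, Finset.mul_sum]
        exact Finset.sum_congr rfl fun x _ => by ring
    _ = ∑ x, (Fintype.card ι : ℂ)⁻¹ * A a b * ((A a x)⁻¹ * (A b x)⁻¹) *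
          ∑ k, B c k / B x k := by
        rw [Finset.sum_comm]
        simp only [Finset.mul_sum]
    _ = A a b / (A a c * A b c) := by
        simp only [hB.sum_div, mul_ite, mul_zero, Finset.sum_ite_eq, Finset.mem_univ, if_true]
        field_simp

end

/-! ### Signs and the block matrix -/

section

variable {ι : Type*}

/-- The sign attached to an index of a doubled index set. -/
def blockSign : ι ⊕ ι → ℂ := Sum.elim (fun _ => 1) (fun _ => -1)

/-- The underlying index of an index of a doubled index set. -/
def blockIdx : ι ⊕ ι → ι := Sum.elim id id

theorem blockSign_mul_self (p : ι ⊕ ι) : blockSign p * blockSign p = 1 := by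
  cases p <;> simp [blockSign]

theorem blockSign_inv (p : ι ⊕ ι) : (blockSign p)⁻¹ = blockSign p := by
  cases p <;> simp [blockSign, inv_neg]

theorem blockSign_ne_zero (p : ι ⊕ ι) : blockSign p ≠ 0 := by
  cases p <;> simp [blockSign]

theorem sum_blockSign_mul [Fintype ι] (f : ι → ℂ) :
    ∑ p : ι ⊕ ι, blockSign p * f (blockIdx p) = 0 := by
  simp [Fintype.sum_sum_type, blockSign, blockIdx]

theorem sum_blockIdx [Fintype ι] (f : ι → ℂ) :
    ∑ p : ι ⊕ ι, f (blockIdx p) = 2 * ∑ x, f x := by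
  simp [Fintype.sum_sum_type, blockIdx, two_mul]

/-- The `A` and `B` contributions to a row product cancel for rows with equal base index and
opposite signs, and add up on the diagonal. -/
theorem blockSign_mul_ite_add_ite [DecidableEq ι] (p q : ι ⊕ ι) (z : ℂ) :
    blockSign p * blockSign q * (if blockIdx p = blockIdx q then z else 0) +
      (if blockIdx q = blockIdx p then z else 0) = if p = q then 2 * z else 0 := by
  rw [if_congr (eq_comm (a := blockIdx q)) rfl rfl]
  by_cases h : blockIdx p = blockIdx q
  · rw [if_pos h]
    rcases p with p | p <;> rcases q with q | q <;>
      simp_all [blockSign, blockIdx, two_mul]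
  · have hpq : p ≠ q := fun hpq => h (congrArg blockIdx hpq)
    simp [h, hpq]

variable (d : ℂ) (A B : Matrix ι ι ℂ) (p q : ι ⊕ ι)

theorem matV_inl_inl : matV d A B (.inl p) (.inl q) =
    blockSign p * blockSign q * (d * A (blockIdx p) (blockIdx q)) := by
  rcases p with p | p <;> rcases q with q | q <;> simp [matV, blockSign, blockIdx]

theorem matV_inr_inr : matV d A B (.inr p) (.inr q) =
    blockSign p * blockSign q * (d * A (blockIdx p) (blockIdx q)) := by
  rcases p with p | p <;> rcases q with q | q <;> simp [matV, blockSign, blockIdx]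

theorem matV_inl_inr : matV d A B (.inl p) (.inr q) = (B (blockIdx p) (blockIdx q))⁻¹ := by
  rcases p with p | p <;> rcases q with q | q <;> simp [matV, schurInv, blockIdx]

theorem matV_inr_inl : matV d A B (.inr p) (.inl q) = (B (blockIdx q) (blockIdx p))⁻¹ := by
  rcases p with p | p <;> rcases q with q | q <;> simp [matV, schurInv, blockIdx]

/-- Exchanging the two halves of the index set amounts to transposing `B`. -/
theorem matV_swap (x y : (ι ⊕ ι) ⊕ (ι ⊕ ι)) :
    matV d A B x.swap y.swap = matV d A Bᵀ x y := by
  rcases x with x | x <;> rcases y with y | y <;>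
    simp [matV_inl_inl, matV_inl_inr, matV_inr_inl, matV_inr_inr]

theorem matV_isSymm {A : Matrix ι ι ℂ} (hA : A.IsSymm) : (matV d A B).IsSymm := by
  refine Matrix.IsSymm.ext fun x y => ?_
  rcases x with x | x <;> rcases y with y | y <;>
    simp only [matV_inl_inl, matV_inl_inr, matV_inr_inl, matV_inr_inr] <;>
    rw [hA.apply] <;> ring

variable {d A B} [Fintype ι]

/-! ### Sums of products of entries of the block matrix -/

theorem sum_matV_swap (f : ℂ → ℂ → ℂ → ℂ) (a b c : (ι ⊕ ι) ⊕ (ι ⊕ ι)) :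
    ∑ x, f (matV d A B a.swap x) (matV d A B b.swap x) (matV d A B c.swap x) =
      ∑ x, f (matV d A Bᵀ a x) (matV d A Bᵀ b x) (matV d A Bᵀ c x) := by
  rw [← (Equiv.sumComm (ι ⊕ ι) (ι ⊕ ι)).sum_comp]
  simp only [Equiv.sumComm_apply, matV_swap]

/-- The first half has three factors of the sign of `x` and cancels; the sign-free second half
doubles. -/
theorem sum_matV_inl_inl_inl (a b c : ι ⊕ ι) :
    ∑ x, matV d A B (.inl a) x * matV d A B (.inl b) x / matV d A B (.inl c) x =
      2 * ∑ x, B (blockIdx c) x / (B (blockIdx a) x * B (blockIdx b) x) := by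
  rw [Fintype.sum_sum_type, ← sum_blockIdx]
  simp only [matV_inl_inl, matV_inl_inr]
  refine (congrArg₂ (· + ·) ?_ ?_).trans (zero_add _)
  · rw [← sum_blockSign_mul fun x => blockSign a * blockSign b * blockSign c *
      (d * A (blockIdx a) x * (d * A (blockIdx b) x) / (d * A (blockIdx c) x))]
    refine Finset.sum_congr rfl fun x _ => ?_
    simp only [div_eq_mul_inv, mul_inv, blockSign_inv]
    linear_combination (blockSign a * blockSign b * blockSign c * blockSign x *
      (d * A (blockIdx a) (blockIdx x) * (d * A (blockIdx b) (blockIdx x)) *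
        (d⁻¹ * (A (blockIdx c) (blockIdx x))⁻¹))) * blockSign_mul_self x
  · refine Finset.sum_congr rfl fun x _ => ?_
    simp only [div_eq_mul_inv, mul_inv, inv_inv]
    ring

/-- The sign of `x` occurs twice in the first half and once in the second, so only the first
survives. -/
theorem sum_matV_inl_inl_inr (a b c : ι ⊕ ι) :
    ∑ x, matV d A B (.inl a) x * matV d A B (.inl b) x / matV d A B (.inr c) x =
      2 * (blockSign a * blockSign b * d ^ 2 *
        ∑ x, A (blockIdx a) x * A (blockIdx b) x * B x (blockIdx c)) := by
  rw [Fintype.sum_sum_type, Finset.mul_sum, ← sum_blockIdx]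
  simp only [matV_inl_inl, matV_inl_inr, matV_inr_inl, matV_inr_inr]
  refine (congrArg₂ (· + ·) ?_ ?_).trans (add_zero _)
  · refine Finset.sum_congr rfl fun x _ => ?_
    simp only [div_eq_mul_inv, inv_inv]
    linear_combination (blockSign a * blockSign b * d ^ 2 * A (blockIdx a) (blockIdx x) *
      A (blockIdx b) (blockIdx x) * B (blockIdx x) (blockIdx c)) * blockSign_mul_self x
  · rw [← sum_blockSign_mul fun x => blockSign c *
      ((B (blockIdx a) x)⁻¹ * (B (blockIdx b) x)⁻¹ / (d * A (blockIdx c) x))]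
    refine Finset.sum_congr rfl fun x _ => ?_
    simp only [div_eq_mul_inv, mul_inv, blockSign_inv]
    ring

theorem sum_matV_inl_inr_inl (hd : d ≠ 0) (a b c : ι ⊕ ι) :
    ∑ x, matV d A B (.inl a) x * matV d A B (.inr b) x / matV d A B (.inl c) x =
      2 * (blockSign a * blockSign c *
        ∑ x, A (blockIdx a) x / (A (blockIdx c) x * B x (blockIdx b))) := by
  rw [Fintype.sum_sum_type, Finset.mul_sum, ← sum_blockIdx]
  simp only [matV_inl_inl, matV_inl_inr, matV_inr_inl, matV_inr_inr]
  refine (congrArg₂ (· + ·) ?_ ?_).trans (add_zero _)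
  · refine Finset.sum_congr rfl fun x _ => ?_
    simp only [div_eq_mul_inv, mul_inv, blockSign_inv]
    have hx : blockSign x * blockSign x * (d * d⁻¹) = 1 := by
      rw [blockSign_mul_self, mul_inv_cancel₀ hd, one_mul]
    linear_combination (blockSign a * blockSign c * A (blockIdx a) (blockIdx x) *
      (A (blockIdx c) (blockIdx x))⁻¹ * (B (blockIdx x) (blockIdx b))⁻¹) * hx
  · rw [← sum_blockSign_mul fun x => blockSign b *
      ((B (blockIdx a) x)⁻¹ * (d * A (blockIdx b) x) * B (blockIdx c) x)]
    refine Finset.sum_congr rfl fun x _ => ?_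
    simp only [div_eq_mul_inv, inv_inv]
    ring

theorem sum_matV_inl_div_inl (hd : d ≠ 0) (a c : ι ⊕ ι) :
    ∑ x, matV d A B (.inl a) x / matV d A B (.inl c) x =
      2 * (blockSign a * blockSign c * ∑ x, A (blockIdx a) x / A (blockIdx c) x +
        ∑ x, B (blockIdx c) x / B (blockIdx a) x) := by
  rw [Fintype.sum_sum_type, mul_add, Finset.mul_sum, ← sum_blockIdx, ← sum_blockIdx]
  simp only [matV_inl_inl, matV_inl_inr]
  congr 1 <;> refine Finset.sum_congr rfl fun x _ => ?_
  · have hx : blockSign x * blockSign x * (d * d⁻¹) = 1 := by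
      rw [blockSign_mul_self, mul_inv_cancel₀ hd, one_mul]
    simp only [div_eq_mul_inv, mul_inv, blockSign_inv]
    linear_combination (blockSign a * blockSign c * A (blockIdx a) (blockIdx x) *
      (A (blockIdx c) (blockIdx x))⁻¹) * hx
  · simp only [div_eq_mul_inv, inv_inv]
    ring

/-- In each half exactly one factor carries the sign of `x`. -/
theorem sum_matV_inl_div_inr (a c : ι ⊕ ι) :
    ∑ x, matV d A B (.inl a) x / matV d A B (.inr c) x = 0 := by
  rw [Fintype.sum_sum_type]
  simp only [matV_inl_inl, matV_inl_inr, matV_inr_inl, matV_inr_inr]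
  refine (congrArg₂ (· + ·) ?_ ?_).trans (add_zero _)
  · rw [← sum_blockSign_mul fun x => blockSign a * (d * A (blockIdx a) x * B x (blockIdx c))]
    refine Finset.sum_congr rfl fun x _ => ?_
    simp only [div_eq_mul_inv, inv_inv]
    ring
  · rw [← sum_blockSign_mul fun x => blockSign c *
      ((B (blockIdx a) x)⁻¹ / (d * A (blockIdx c) x))]
    refine Finset.sum_congr rfl fun x _ => ?_
    simp only [div_eq_mul_inv, mul_inv, blockSign_inv]
    ring

/-! ### The block matrix is always type II -/

theorem sum_matV_inl_div [DecidableEq ι] (hd : d ≠ 0) (hA : IsTypeII A) (hB : IsTypeII B)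
    (a : ι ⊕ ι) (c : (ι ⊕ ι) ⊕ (ι ⊕ ι)) :
    ∑ x, matV d A B (.inl a) x / matV d A B c x =
      if .inl a = c then 4 * (Fintype.card ι : ℂ) else 0 := by
  rcases c with c | c
  · rw [sum_matV_inl_div_inl hd, hA.sum_div, hB.sum_div, blockSign_mul_ite_add_ite]
    by_cases h : a = c <;> simp [h]
    ring
  · rw [sum_matV_inl_div_inr]
    simp

theorem matV_isTypeII [DecidableEq ι] (hd : d ≠ 0) (hA : IsTypeII A) (hB : IsTypeII B) :
    IsTypeII (matV d A B) := by
  refine ⟨fun x y => ?_, Matrix.ext fun x y => ?_⟩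
  · rcases x with x | x <;> rcases y with y | y <;>
      simp [matV_inl_inl, matV_inl_inr, matV_inr_inl, matV_inr_inr, hd, hA.ne_zero, hB.ne_zero,
        blockSign_ne_zero]
  · have hcard : (Fintype.card ((ι ⊕ ι) ⊕ (ι ⊕ ι)) : ℂ) = 4 * Fintype.card ι := by
      simp only [Fintype.card_sum]
      push_cast
      ring
    have h : ∑ z, matV d A B x z / matV d A B y z =
        if x = y then 4 * (Fintype.card ι : ℂ) else 0 := by
      rcases x with x | x
      · exact sum_matV_inl_div hd hA hB x y
      · have h1 := sum_matV_inl_div hd hA hB.transpose x y.swap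
        rw [← sum_matV_swap (fun u _ v => u / v) (.inl x) (.inl x) y.swap, Sum.swap_swap] at h1
        rw [Sum.swap_inl] at h1
        rw [h1]
        rcases y with y | y <;> simp
    rw [Matrix.smul_apply, hcard, Matrix.mul_apply]
    simpa [schurInv, Matrix.one_apply, div_eq_mul_inv] using h

/-! ### The star-triangle relation of the block matrix -/

theorem star_triangle_matV_inl_left [DecidableEq ι] (hd : d ≠ 0) (hA : IsTypeII A)
    (hB : IsTypeII B) (hAs : A.IsSymm) (h : IsOneSidedJonesPair A B) (a : ι ⊕ ι)
    (b c : (ι ⊕ ι) ⊕ (ι ⊕ ι)) (hbc : b.isLeft ∨ c.isLeft) :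
    ∑ x, matV d A B (.inl a) x * matV d A B b x / matV d A B c x =
      2 * d * (matV d A B (.inl a) b / (matV d A B (.inl a) c * matV d A B b c)) := by
  have h2 := mul_inv_cancel₀ hd
  rcases b with b | b <;> rcases c with c | c
  · rw [sum_matV_inl_inl_inl, sum_div_mul_self hA hB hAs h]
    simp only [matV_inl_inl, div_eq_mul_inv, mul_inv, blockSign_inv]
    have hs : blockSign a * blockSign a * (blockSign b * blockSign b) *
        (blockSign c * blockSign c) * (d * d⁻¹) * (d * d⁻¹) = 1 := by
      simp only [blockSign_mul_self, h2, one_mul]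
    linear_combination (-2 * A (blockIdx a) (blockIdx b) * (A (blockIdx a) (blockIdx c))⁻¹ *
      (A (blockIdx b) (blockIdx c))⁻¹) * hs
  · rw [sum_matV_inl_inl_inr, (isOneSidedJonesPair_iff_of_isSymm hAs).mp h]
    simp only [matV_inl_inl, matV_inl_inr, div_eq_mul_inv, mul_inv, inv_inv]
    ring
  · rw [sum_matV_inl_inr_inl hd, sum_div_mul hA hB.ne_zero hAs h]
    simp only [matV_inl_inl, matV_inl_inr, matV_inr_inl, div_eq_mul_inv, mul_inv, inv_inv,
      blockSign_inv]
    linear_combination (-2 * blockSign a * blockSign c * (B (blockIdx a) (blockIdx b))⁻¹ *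
      (A (blockIdx a) (blockIdx c))⁻¹ * B (blockIdx c) (blockIdx b)) * h2
  · simp at hbc

/-- The star-triangle relation when at least two of the three indices lie in the first half. -/
theorem star_triangle_matV_two_inl [DecidableEq ι] (hd : d ≠ 0) (hA : IsTypeII A)
    (hB : IsTypeII B) (hAs : A.IsSymm) (h : IsOneSidedJonesPair A B)
    (a b c : (ι ⊕ ι) ⊕ (ι ⊕ ι))
    (habc : (a.isLeft ∧ (b.isLeft ∨ c.isLeft)) ∨ (b.isLeft ∧ c.isLeft)) :
    ∑ x, matV d A B a x * matV d A B b x / matV d A B c x =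
      2 * d * (matV d A B a b / (matV d A B a c * matV d A B b c)) := by
  rcases a with a | a
  · exact star_triangle_matV_inl_left hd hA hB hAs h a b c (by tauto)
  · rcases b with b | b
    -- The relation is symmetric in `a` and `b` because `V` is symmetric.
    · have h1 := star_triangle_matV_inl_left hd hA hB hAs h b (.inr a) c
        (Or.inr (by simpa using habc))
      rw [(matV_isSymm d B hAs).apply, mul_comm (matV d A B (.inl b) c)] at h1
      simpa only [mul_comm (matV d A B (.inl b) _)] using h1
    · simp at habc

theorem star_triangle_matV [DecidableEq ι] (hd : d ≠ 0) (hA : IsTypeII A) (hB : IsTypeII B)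
    (hAs : A.IsSymm) (h : IsJonesPair A B) (a b c : (ι ⊕ ι) ⊕ (ι ⊕ ι)) :
    ∑ x, matV d A B a x * matV d A B b x / matV d A B c x =
      2 * d * (matV d A B a b / (matV d A B a c * matV d A B b c)) := by
  by_cases habc : (a.isLeft ∧ (b.isLeft ∨ c.isLeft)) ∨ (b.isLeft ∧ c.isLeft)
  · exact star_triangle_matV_two_inl hd hA hB hAs h.1 a b c habc
  -- Otherwise two indices lie in the second half: swap the halves and use the pair `(A, Bᵀ)`.
  · have h1 := star_triangle_matV_two_inl hd hA hB.transpose hAs h.2 a.swap b.swap c.swap (by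
      rcases a with a | a <;> rcases b with b | b <;> rcases c with c | c <;> simp_all)
    rw [← sum_matV_swap fun u v w => u * v / w] at h1
    simpa only [← matV_swap, Sum.swap_swap] using h1

/-- The star-triangle relation with the first two indices in the first half contains the
one-sided Jones pair relation. -/
theorem isOneSidedJonesPair_of_star_triangle (hd : d ≠ 0) (hAs : A.IsSymm)
    (h : ∀ a b c, ∑ x, matV d A B a x * matV d A B b x / matV d A B c x =
      2 * d * (matV d A B a b / (matV d A B a c * matV d A B b c))) :
    IsOneSidedJonesPair A B := by
  refine (isOneSidedJonesPair_iff_of_isSymm hAs).mpr fun i j k => ?_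
  have h1 := h (.inl (.inl i)) (.inl (.inl j)) (.inr (.inl k))
  rw [sum_matV_inl_inl_inr] at h1
  simp only [matV_inl_inl, matV_inl_inr, div_eq_mul_inv, mul_inv, inv_inv] at h1
  have h2 : (2 * d ^ 2) * ∑ x, A i x * A j x * B x k = (2 * d ^ 2) * (A i j * B i k * B j k) := by
    simp only [blockSign, blockIdx, Sum.elim_inl, id] at h1
    linear_combination h1
  exact mul_left_cancel₀ (by simp [hd]) h2

theorem isSymmetricSpinModel_matV_iff [DecidableEq ι] (hd : d ^ 2 = Fintype.card ι)
    (hA : IsTypeII A) (hB : IsTypeII B) (hAs : A.IsSymm) :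
    IsSymmetricSpinModel (matV d A B) (2 * d) ↔ IsInvertibleJonesPair A B := by
  -- Order zero is separate because it forces `d = 0`, while the block computations divide by `d`.
  cases isEmpty_or_nonempty ι
  · refine ⟨fun _ => ⟨⟨Subsingleton.elim _ _, Subsingleton.elim _ _⟩, hA.isUnit_opX,
      hB.isUnit_opDelta⟩, fun _ => ⟨matV_isSymm d B hAs, ?_, ⟨fun i => isEmptyElim i,
        Subsingleton.elim _ _⟩, fun a => isEmptyElim a⟩⟩
    simpa using hd
  have hd0 : d ≠ 0 := by
    rintro rfl
    simp [eq_comm] at hd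
  constructor
  · intro h
    refine ⟨⟨isOneSidedJonesPair_of_star_triangle hd0 hAs h.star_triangle,
      isOneSidedJonesPair_of_star_triangle hd0 hAs fun a b c => ?_⟩,
      hA.isUnit_opX, hB.isUnit_opDelta⟩
    rw [← sum_matV_swap fun u v w => u * v / w]
    simpa only [matV_swap] using h.star_triangle a.swap b.swap c.swap
  · intro h
    refine ⟨matV_isSymm d B hAs, ?_, matV_isTypeII hd0 hA hB,
      star_triangle_matV hd0 hA hB hAs h.1⟩
    simp only [Fintype.card_sum]
    push_cast
    linear_combination 4 * hd

end

end JonesPairs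

theorem mainTheorem2 (n : ℕ) (d : ℂ) (hd : d ^ 2 = (n : ℂ))
    (A B : Matrix (Fin n) (Fin n) ℂ)
    (hA : JonesPairs.IsTypeII A) (hB : JonesPairs.IsTypeII B) (hAsymm : A.IsSymm) :
    JonesPairs.IsSymmetricSpinModel (JonesPairs.matV d A B) (2 * d) ↔
      JonesPairs.IsInvertibleJonesPair A B :=
  JonesPairs.isSymmetricSpinModel_matV_iff (by simpa using hd) hA hB hAsymm
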